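/- Let $\mathcal L:[0,\infty)\to[1,\infty)$ be nondecreasing with $\mathcal L(0)=1$ and $M:=1+\int_0^\infty\frac{dt}{(t+1)\mathcal L(t)}<\infty$, and assume that $(t+1)\ln\mathcal L(t)$ is convex on $[0,\infty)$. Let $d\ge 1$ be an integer. For $\gamma,\tilde\gamma>0$ let $\mathcal S(d,\mathcal L;\gamma,\tilde\gamma)$ be the set of all $\hat A\in C^\infty[0,\infty)^d$ with $\|\hat A\|_\infty\le\gamma$ and $$\frac1{k!}\|D_j^k\hat A\|_\infty\le\gamma\big(\tilde\gamma\,\mathcal L(k-1)\big)^k\quad\text{for all integers }k\ge1\text{ and all }1\le j\le d,$$ where $D_j^k=\partial^k/\partial t_j^k$ (one-sided at the boundary) and $\|\cdot\|_\infty$ of a function is the supremum over $[0,\infty)^d$. Put $\mathcal B_1:=\{t\in[0,\infty)^d:\ t_1+\dots+t_d\le1\}$ and $\|t\|_\infty:=\max_i|t_i|$, and let $\operatorname{proj}_k t$ be $t$ with its $k$-th coordinate replaced by $0$. A function $\hat A\in C^\infty[0,\infty)^d$ is called admissible of second kind and type $(a)$, $(b)$ or $(c)$ if $\operatorname{supp}\hat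 A\subset[0,2]^d$, if $\hat A(t)=\hat A(\operatorname{proj}_k t)$ for all $1\le k\le d$ and all $t\in[0,\infty)^d$ with $t_k\le\frac12\|t\|_\infty$, and if, respectively, $(a)$ $\hat A(t)=1$ for $t\in\mathcal B_1$; $(b)$ $\hat A(t)=0$ for $t\in\frac12\mathcal B_1$; $(c)$ $\hat A(t)=0$ for $t\in\frac12\mathcal B_1$, and $\sum_{j=0}^\infty|\hat A(2^{-j}t)|^2=1$ for $t\in[0,\infty)^d\setminus[0,1)^d$. Then, for each of the types $(a)$, $(b)$, $(c)$, the set $$\mathcal S\big(d,\mathcal L;\,8,\,10d(2d-1)M(8(d+2)M+1)\big)$$ contains an admissible function $\hat A$ of second kind and of that type, with $0\le\hat A\le1$. -/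

import Mathlib

open Set MeasureTheory
open scoped Pointwise ContDiff

noncomputable section

/-- The conditions on a growth function `L : [0, ∞) → [1, ∞)`: it is nondecreasing, `L 0 = 1`, and
`∫₀^∞ dt / ((t + 1) L(t)) < ∞`. Values of `L` at negative arguments play no role. -/
structure IsGrowthFunction (L : ℝ → ℝ) : Prop where
  one_le : ∀ t, 0 ≤ t → 1 ≤ L t
  monotoneOn : MonotoneOn L (Ici 0)
  map_zero : L 0 = 1
  integrableOn : IntegrableOn (fun t : ℝ => 1 / ((t + 1) * L t)) (Ioi 0)

/-- `M(L) = 1 + ∫₀^∞ dt / ((t + 1) L(t))`. -/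
def growthConst (L : ℝ → ℝ) : ℝ :=
  1 + ∫ t in Ioi (0 : ℝ), 1 / ((t + 1) * L t)

/-- The closed orthant `[0, ∞)^d`. -/
def orthant (d : ℕ) : Set (Fin d → ℝ) :=
  {t | ∀ i, 0 ≤ t i}

/-- `D_j^k A (t)`, the `k`-th partial derivative in the `j`-th variable of a function on `[0, ∞)^d`,
one-sided where `t j = 0`. -/
def partialDeriv {d : ℕ} (j : Fin d) (k : ℕ) (A : (Fin d → ℝ) → ℝ) (t : Fin d → ℝ) : ℝ :=
  iteratedDerivWithin k (fun s : ℝ => A (Function.update t j s)) (Ici 0) (t j)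

/-- The class `S(d, L; γ, γ')` of smooth functions on `[0, ∞)^d` with small derivatives.
Only the values on the orthant matter. -/
def smallDerivClass (d : ℕ) (L : ℝ → ℝ) (γ γ' : ℝ) : Set ((Fin d → ℝ) → ℝ) :=
  {A | ContDiffOn ℝ ∞ A (orthant d) ∧
    (∀ t ∈ orthant d, |A t| ≤ γ) ∧
    ∀ k : ℕ, 1 ≤ k → ∀ j : Fin d, ∀ t ∈ orthant d,
      1 / (k.factorial : ℝ) * |partialDeriv j k A t| ≤ γ * (γ' * L ((k : ℝ) - 1)) ^ k}

/-- `proj_k t`: the `k`-th coordinate is replaced by `0`. -/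
def coordProj {d : ℕ} (k : Fin d) (t : Fin d → ℝ) : Fin d → ℝ :=
  Function.update t k 0

/-- The part `B₁` of the unit ball of the `ℓ¹` norm in the orthant. -/
def ballOne (d : ℕ) : Set (Fin d → ℝ) :=
  {t | t ∈ orthant d ∧ ∑ i, |t i| ≤ 1}

/-- The three types of cutoff functions. -/
inductive CutoffType
  | a
  | b
  | c

/-- The condition defining each type of cutoff function. -/
def HasCutoffType {d : ℕ} (A : (Fin d → ℝ) → ℝ) : CutoffType → Prop
  | .a => ∀ t ∈ ballOne d, A t = 1
  | .b => ∀ t ∈ (1 / 2 : ℝ) • ballOne d, A t = 0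
  | .c => (∀ t ∈ (1 / 2 : ℝ) • ballOne d, A t = 0) ∧
      ∀ t ∈ orthant d \ {t | ∀ i, t i ∈ Ico (0 : ℝ) 1},
        HasSum (fun j : ℕ => |A (((2 : ℝ) ^ j)⁻¹ • t)| ^ 2) 1

/-- Admissible `d`-variate cutoff functions of the second kind, of a given type. The norm on
`Fin d → ℝ` is the maximum norm. -/
structure IsAdmissibleSecondKind {d : ℕ} (τ : CutoffType) (A : (Fin d → ℝ) → ℝ) : Prop where
  contDiffOn : ContDiffOn ℝ ∞ A (orthant d)
  support_subset :
    closure {t | t ∈ orthant d ∧ A t ≠ 0} ⊆ {t | ∀ i, t i ∈ Icc (0 : ℝ) 2}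
  eq_proj : ∀ t ∈ orthant d, ∀ k : Fin d, t k ≤ 1 / 2 * ‖t‖ → A t = A (coordProj k t)
  hasType : HasCutoffType A τ

end

open Filter Topology

/-! Everything reduces to a cutoff `g` on the line, equal to 1 on `(-∞, 1]` and 0 on `[2, ∞)`, with
`|g⁽ᵏ⁾| ≤ k! (4 M L(k - 1))ᵏ`. It is the limit of repeated box averages of a smooth step. Averaging
over width `a` never increases a sup norm, and it gives one derivative at the price of a factor `2 /
a`, so the limit satisfies `|g⁽ᵏ⁾| ≤ ∏_{i<k} 2 / a i`. The widths may have total at most 1/2. Since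
`∑ 1 / ((i + 1) L(i)) ≤ M`, the choice `a i = 1 / (2 M (i + 1) L(i))` is allowed, and the product
becomes `(4 M)ᵏ k! ∏ L(i)` (`exists_cutoff_of_sum_le`, `IsGrowthFunction.exists_cutoff`).

In `d` variables, `G(t) = ∏ g(t_i)` has type (a). Types (b) and (c) are both served by `sin(π/2
G(t)) cos(π/2 G(2t))`, whose square is `sin²(π/2 G(t)) - sin²(π/2 G(2t))`, so the dyadic sum
telescopes. Along a coordinate line `G` is a constant in `[0, 1]` times `g`; sine and cosine cost a
factor 4 in the geometric rate, the dilation 2 and the product 2. The resulting rate `64 M L(k - 1)`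
is below the required one. -/

/-! ### Box averages -/

/-- The average of `f` over `[x - a, x]`. -/
noncomputable def boxAverage (a : ℝ) (f : ℝ → ℝ) (x : ℝ) : ℝ :=
  a⁻¹ * ∫ y in (x - a)..x, f y

theorem hasDerivAt_boxAverage {a : ℝ} {f : ℝ → ℝ} (hf : Continuous f) (x : ℝ) :
    HasDerivAt (boxAverage a f) (a⁻¹ * (f x - f (x - a))) x := by
  have hint : ∀ u v, IntervalIntegrable f volume u v := fun u v => hf.intervalIntegrable u v
  have hprim : ∀ z, HasDerivAt (fun u => ∫ y in (0 : ℝ)..u, f y) (f z) z := fun z =>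
    intervalIntegral.integral_hasDerivAt_right (hint 0 z)
      hf.stronglyMeasurable.stronglyMeasurableAtFilter hf.continuousAt
  have heq : boxAverage a f =
      fun z => a⁻¹ * ((∫ y in (0 : ℝ)..z, f y) - ∫ y in (0 : ℝ)..(z - a), f y) := by
    funext z
    rw [boxAverage, intervalIntegral.integral_interval_sub_left (hint _ _) (hint _ _)]
  rw [heq]
  have h2 : HasDerivAt (fun z => ∫ y in (0 : ℝ)..(z - a), f y) (f (x - a)) x :=
    HasDerivAt.comp_sub_const x a (hprim (x - a))
  exact ((hprim x).sub h2).const_mul _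

theorem boxAverage_deriv {a : ℝ} {f : ℝ → ℝ} (hf : ContDiff ℝ ∞ f) (x : ℝ) :
    boxAverage a (deriv f) x = a⁻¹ * (f x - f (x - a)) := by
  have h := contDiff_infty_iff_deriv.1 hf
  rw [boxAverage, intervalIntegral.integral_deriv_eq_sub (fun y _ => h.1 y)
    (h.2.continuous.intervalIntegrable _ _)]

theorem deriv_boxAverage {a : ℝ} {f : ℝ → ℝ} (hf : ContDiff ℝ ∞ f) :
    deriv (boxAverage a f) = boxAverage a (deriv f) := by
  funext x
  rw [(hasDerivAt_boxAverage hf.continuous x).deriv, boxAverage_deriv hf]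

theorem contDiff_boxAverage {a : ℝ} {f : ℝ → ℝ} (hf : ContDiff ℝ ∞ f) :
    ContDiff ℝ ∞ (boxAverage a f) := by
  refine contDiff_infty_iff_deriv.2
    ⟨fun x => (hasDerivAt_boxAverage hf.continuous x).differentiableAt, ?_⟩
  have : deriv (boxAverage a f) = fun x => a⁻¹ * (f x - f (x - a)) :=
    funext fun x => (hasDerivAt_boxAverage hf.continuous x).deriv
  rw [this]
  fun_prop

theorem contDiff_iteratedDeriv {f : ℝ → ℝ} (hf : ContDiff ℝ ∞ f) (k : ℕ) :
    ContDiff ℝ ∞ (iteratedDeriv k f) := by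
  rw [iteratedDeriv_eq_iterate]
  exact ContDiff.iterate_deriv k hf

theorem iteratedDeriv_boxAverage {a : ℝ} {f : ℝ → ℝ} (hf : ContDiff ℝ ∞ f) (k : ℕ) :
    iteratedDeriv k (boxAverage a f) = boxAverage a (iteratedDeriv k f) := by
  induction k with
  | zero => simp [iteratedDeriv_zero]
  | succ k ih =>
    rw [iteratedDeriv_succ, ih, deriv_boxAverage (contDiff_iteratedDeriv hf k), iteratedDeriv_succ]

theorem boxAverage_mem_Icc {a : ℝ} (ha : 0 < a) {f : ℝ → ℝ} (hf : Continuous f) {m M x : ℝ}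
    (h : ∀ y ∈ Icc (x - a) x, f y ∈ Icc m M) : boxAverage a f x ∈ Icc m M := by
  have hle : x - a ≤ x := by linarith
  have h1 := intervalIntegral.integral_mono_on hle
    (intervalIntegrable_const (c := m) (μ := volume))
    (hf.intervalIntegrable _ _) (fun y hy => (h y hy).1)
  have h2 := intervalIntegral.integral_mono_on hle (hf.intervalIntegrable _ _)
    (intervalIntegrable_const (c := M) (μ := volume)) (fun y hy => (h y hy).2)
  simp only [intervalIntegral.integral_const, sub_sub_cancel, smul_eq_mul] at h1 h2
  rw [boxAverage, mem_Icc, inv_mul_eq_div, le_div_iff₀ ha, div_le_iff₀ ha]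
  constructor <;> linarith

theorem abs_boxAverage_le {a : ℝ} (ha : 0 < a) {f : ℝ → ℝ} (hf : Continuous f) {C : ℝ}
    (h : ∀ y, |f y| ≤ C) (x : ℝ) : |boxAverage a f x| ≤ C :=
  abs_le.2 (boxAverage_mem_Icc ha hf fun y _ => abs_le.1 (h y))

theorem boxAverage_eq_const {a : ℝ} (ha : 0 < a) {f : ℝ → ℝ} (hf : Continuous f) {c x : ℝ}
    (h : ∀ y ∈ Icc (x - a) x, f y = c) : boxAverage a f x = c := by
  have := boxAverage_mem_Icc ha hf (m := c) (M := c) (x := x) fun y hy => by simp [h y hy]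
  simpa using this

/-- The derivative of the average is a difference quotient of `f`, so no derivative of `f` enters
the bound. -/
theorem abs_deriv_boxAverage_le {a : ℝ} (ha : 0 < a) {f : ℝ → ℝ} (hf : Continuous f) {C : ℝ}
    (h : ∀ y, |f y| ≤ C) (x : ℝ) : |deriv (boxAverage a f) x| ≤ C * (2 / a) := by
  rw [(hasDerivAt_boxAverage hf x).deriv, abs_mul, abs_of_pos (inv_pos.2 ha)]
  have : |f x - f (x - a)| ≤ 2 * C := by
    have := abs_sub (f x) (f (x - a))
    linarith [h x, h (x - a)]
  calc a⁻¹ * |f x - f (x - a)| ≤ a⁻¹ * (2 * C) := by gcongr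
    _ = C * (2 / a) := by ring

theorem abs_boxAverage_sub_le {a : ℝ} (ha : 0 < a) {f : ℝ → ℝ} (hf : ContDiff ℝ ∞ f) {C : ℝ}
    (h : ∀ y, |deriv f y| ≤ C) (x : ℝ) : |boxAverage a f x - f x| ≤ a * C := by
  have hmv : ∀ y ∈ Icc (x - a) x, |f y - f x| ≤ a * C := by
    intro y hy
    have := Convex.norm_image_sub_le_of_norm_deriv_le (f := f) (s := univ) (x := x) (y := y)
      (fun z _ => (contDiff_infty_iff_deriv.1 hf).1 z) (fun z _ => h z) convex_univ trivial trivial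
    rw [Real.norm_eq_abs, Real.norm_eq_abs] at this
    have hxy : |y - x| ≤ a := abs_le.2 ⟨by linarith [hy.1], by linarith [hy.2]⟩
    have hC : 0 ≤ C := (abs_nonneg _).trans (h x)
    calc |f y - f x| ≤ C * |y - x| := this
      _ ≤ C * a := by gcongr
      _ = a * C := mul_comm _ _
  have := boxAverage_mem_Icc ha hf.continuous (m := f x - a * C) (M := f x + a * C) (x := x)
    fun y hy => by
      have := abs_le.1 (hmv y hy)
      exact ⟨by linarith, by linarith⟩
  exact abs_le.2 ⟨by linarith [this.1], by linarith [this.2]⟩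

/-! ### Limits of smooth functions -/

/-- The limit is written as a telescoping series, which summable bounds at every order allow to be
differentiated term by term. -/
theorem exists_contDiff_tendsto_iteratedDeriv {F : ℕ → ℝ → ℝ} (hF : ∀ n, ContDiff ℝ ∞ (F n))
    {v : ℕ → ℕ → ℝ} (hv : ∀ k, Summable (v k))
    (hb : ∀ k n x, |iteratedDeriv k (F (n + 1)) x - iteratedDeriv k (F n) x| ≤ v k n) :
    ∃ g : ℝ → ℝ, ContDiff ℝ ∞ g ∧
      ∀ k x, Tendsto (fun n => iteratedDeriv k (F n) x) atTop (𝓝 (iteratedDeriv k g x)) := by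
  have hder : ∀ k n x, HasDerivAt (iteratedDeriv k (F n)) (iteratedDeriv (k + 1) (F n) x) x := by
    intro k n x
    rw [iteratedDeriv_succ]
    exact ((contDiff_infty_iff_deriv.1 (contDiff_iteratedDeriv (hF n) k)).1 x).hasDerivAt
  have hsum : ∀ k x,
      Summable fun n => iteratedDeriv k (F (n + 1)) x - iteratedDeriv k (F n) x := fun k x =>
    Summable.of_norm_bounded (hv k) fun n => hb k n x
  set G : ℕ → ℝ → ℝ := fun k x => iteratedDeriv k (F 0) x +
    ∑' n, (iteratedDeriv k (F (n + 1)) x - iteratedDeriv k (F n) x) with hG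
  have hGder : ∀ k x, HasDerivAt (G k) (G (k + 1) x) x := fun k x =>
    (hder k 0 x).add (hasDerivAt_tsum (hv (k + 1))
      (fun n y => (hder k (n + 1) y).sub (hder k n y)) (fun n y => hb (k + 1) n y) (hsum k x) x)
  have hGit : ∀ k, iteratedDeriv k (G 0) = G k := by
    intro k
    induction k with
    | zero => exact iteratedDeriv_zero
    | succ k ih => rw [iteratedDeriv_succ, ih]; exact funext fun x => (hGder k x).deriv
  refine ⟨G 0, contDiff_of_differentiable_iteratedDeriv fun m _ => ?_, fun k x => ?_⟩
  · rw [hGit]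
    exact fun x => (hGder m x).differentiableAt
  · rw [hGit]
    have := ((hsum k x).hasSum.tendsto_sum_nat).const_add (iteratedDeriv k (F 0) x)
    refine this.congr fun n => ?_
    rw [Finset.sum_range_sub (fun n => iteratedDeriv k (F n) x)]
    ring

/-! ### A univariate cutoff function -/

/-- A smooth function which is `1` on `(-∞, 1]` and `0` on `[3 / 2, ∞)`. -/
noncomputable def smoothStep (x : ℝ) : ℝ :=
  1 - Real.smoothTransition (2 * (x - 1))

theorem contDiff_smoothStep : ContDiff ℝ ∞ smoothStep :=
  contDiff_const.sub (Real.smoothTransition.contDiff.comp (by fun_prop))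

theorem smoothStep_of_le {x : ℝ} (hx : x ≤ 1) : smoothStep x = 1 := by
  rw [smoothStep, Real.smoothTransition.zero_of_nonpos (by linarith), sub_zero]

theorem smoothStep_of_ge {x : ℝ} (hx : 3 / 2 ≤ x) : smoothStep x = 0 := by
  rw [smoothStep, Real.smoothTransition.one_of_one_le (by linarith), sub_self]

theorem smoothStep_mem_Icc (x : ℝ) : smoothStep x ∈ Icc (0 : ℝ) 1 := by
  have h1 := Real.smoothTransition.le_one (2 * (x - 1))
  have h2 := Real.smoothTransition.nonneg (2 * (x - 1))
  constructor <;> rw [smoothStep] <;> linarith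

theorem hasCompactSupport_deriv_smoothStep : HasCompactSupport (deriv smoothStep) := by
  refine HasCompactSupport.intro (isCompact_Icc (a := (1 : ℝ)) (b := 3 / 2)) fun x hx => ?_
  rcases lt_or_ge x 1 with h | h
  · have : smoothStep =ᶠ[𝓝 x] fun _ => 1 := by
      filter_upwards [Iio_mem_nhds h] with y hy using smoothStep_of_le (le_of_lt hy)
    rw [this.deriv_eq, deriv_const]
  · have h' : 3 / 2 < x := by
      by_contra hc
      exact hx ⟨h, not_lt.1 hc⟩
    have : smoothStep =ᶠ[𝓝 x] fun _ => 0 := by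
      filter_upwards [Ioi_mem_nhds h'] with y hy using smoothStep_of_ge (le_of_lt hy)
    rw [this.deriv_eq, deriv_const]

theorem exists_abs_iteratedDeriv_smoothStep_le (k : ℕ) :
    ∃ C, ∀ x, |iteratedDeriv (k + 1) smoothStep x| ≤ C := by
  have hsupp : HasCompactSupport (iteratedDeriv (k + 1) smoothStep) := by
    induction k with
    | zero => simpa [iteratedDeriv_one] using hasCompactSupport_deriv_smoothStep
    | succ k ih => rw [iteratedDeriv_succ]; exact ih.deriv
  exact (contDiff_iteratedDeriv contDiff_smoothStep (k + 1)).continuous.bounded_above_of_compact_support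
    hsupp

/-- The smooth step averaged over boxes of widths `a 0, …, a (n - 1)`. -/
noncomputable def averagedStep (a : ℕ → ℝ) : ℕ → ℝ → ℝ
  | 0 => smoothStep
  | n + 1 => boxAverage (a n) (averagedStep a n)

section averagedStep

variable {a : ℕ → ℝ}

theorem contDiff_averagedStep (a : ℕ → ℝ) (n : ℕ) : ContDiff ℝ ∞ (averagedStep a n) := by
  induction n with
  | zero => exact contDiff_smoothStep
  | succ n ih => exact contDiff_boxAverage ih

theorem averagedStep_mem_Icc (ha : ∀ n, 0 < a n) (n : ℕ) (x : ℝ) :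
    averagedStep a n x ∈ Icc (0 : ℝ) 1 := by
  induction n generalizing x with
  | zero => exact smoothStep_mem_Icc x
  | succ n ih => exact boxAverage_mem_Icc (ha n) (contDiff_averagedStep a n).continuous fun y _ => ih y

/-- The averaging window lies to the left of `x`, so the plateau on `(-∞, 1]` survives exactly; only
the zero set recedes, by the total width. -/
theorem averagedStep_of_le (ha : ∀ n, 0 < a n) (n : ℕ) {x : ℝ} (hx : x ≤ 1) :
    averagedStep a n x = 1 := by
  induction n generalizing x with
  | zero => exact smoothStep_of_le hx
  | succ n ih =>
    exact boxAverage_eq_const (ha n) (contDiff_averagedStep a n).continuous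
      fun y hy => ih (hy.2.trans hx)

theorem averagedStep_of_ge (ha : ∀ n, 0 < a n) (n : ℕ) {x : ℝ}
    (hx : 3 / 2 + ∑ i ∈ Finset.range n, a i ≤ x) : averagedStep a n x = 0 := by
  induction n generalizing x with
  | zero => exact smoothStep_of_ge (by simpa using hx)
  | succ n ih =>
    rw [Finset.sum_range_succ] at hx
    exact boxAverage_eq_const (ha n) (contDiff_averagedStep a n).continuous
      fun y hy => ih (by linarith [hy.1])

/-- This bound is not explicit but is uniform in `n`; it serves only for convergence of the
derivatives. -/
theorem abs_iteratedDeriv_averagedStep_le_of_smoothStep (ha : ∀ n, 0 < a n) {k : ℕ} {C : ℝ}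
    (h : ∀ x, |iteratedDeriv k smoothStep x| ≤ C) (n : ℕ) (x : ℝ) :
    |iteratedDeriv k (averagedStep a n) x| ≤ C := by
  induction n generalizing x with
  | zero => exact h x
  | succ n ih =>
    rw [averagedStep, iteratedDeriv_boxAverage (contDiff_averagedStep a n)]
    exact abs_boxAverage_le (ha n)
      (contDiff_iteratedDeriv (contDiff_averagedStep a n) k).continuous ih x

theorem abs_iteratedDeriv_averagedStep_le (ha : ∀ n, 0 < a n) {k n : ℕ} (hkn : k ≤ n) (x : ℝ) :
    |iteratedDeriv k (averagedStep a n) x| ≤ ∏ i ∈ Finset.range k, (2 / a i) := by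
  induction n generalizing k x with
  | zero =>
    obtain rfl : k = 0 := by omega
    have := smoothStep_mem_Icc x
    simpa [averagedStep, abs_of_nonneg this.1] using this.2
  | succ n ih =>
    have hs := contDiff_averagedStep a n
    rcases Nat.lt_or_ge n k with h | h
    -- At top order the newest average supplies the last derivative and its factor `2 / a n`; at
    -- lower orders it merely preserves the earlier bound.
    · obtain rfl : k = n + 1 := by omega
      rw [averagedStep, iteratedDeriv_succ, iteratedDeriv_boxAverage hs, Finset.prod_range_succ]
      exact abs_deriv_boxAverage_le (ha n) (contDiff_iteratedDeriv hs n).continuous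
        (fun y => ih le_rfl y) x
    · rw [averagedStep, iteratedDeriv_boxAverage hs]
      exact abs_boxAverage_le (ha n) (contDiff_iteratedDeriv hs k).continuous (fun y => ih h y) x

theorem exists_cutoff_of_sum_le (ha : ∀ n, 0 < a n)
    (hsum : ∀ n, ∑ i ∈ Finset.range n, a i ≤ 1 / 2) :
    ∃ g : ℝ → ℝ, ContDiff ℝ ∞ g ∧ (∀ x, g x ∈ Icc (0 : ℝ) 1) ∧ (∀ x ≤ 1, g x = 1) ∧
      (∀ x, 2 ≤ x → g x = 0) ∧
      ∀ k x, |iteratedDeriv k g x| ≤ ∏ i ∈ Finset.range k, (2 / a i) := by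
  have hs : Summable a := summable_of_sum_range_le (fun n => (ha n).le) hsum
  choose C hC using exists_abs_iteratedDeriv_smoothStep_le
  obtain ⟨g, hg, hlim⟩ := exists_contDiff_tendsto_iteratedDeriv (contDiff_averagedStep a)
    -- `C k` bounds the derivative of order `k + 1`, which controls how far one averaging moves the
    -- derivative of order `k`.
    (v := fun k n => a n * C k) (fun k => hs.mul_right (C k)) (fun k n x => by
      have hn := contDiff_averagedStep a n
      rw [averagedStep, iteratedDeriv_boxAverage hn]
      refine abs_boxAverage_sub_le (ha n) (contDiff_iteratedDeriv hn k) (fun y => ?_) x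
      rw [← iteratedDeriv_succ]
      exact abs_iteratedDeriv_averagedStep_le_of_smoothStep ha (hC k) n y)
  have hlim0 : ∀ x, Tendsto (fun n => averagedStep a n x) atTop (𝓝 (g x)) := fun x => by
    simpa only [iteratedDeriv_zero] using hlim 0 x
  refine ⟨g, hg, fun x => ?_, fun x hx => ?_, fun x hx => ?_, fun k x => ?_⟩
  · exact isClosed_Icc.mem_of_tendsto (hlim0 x)
      (Eventually.of_forall fun n => averagedStep_mem_Icc ha n x)
  · exact tendsto_nhds_unique (hlim0 x)
      (tendsto_const_nhds.congr fun n => (averagedStep_of_le ha n hx).symm)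
  · exact tendsto_nhds_unique (hlim0 x) (tendsto_const_nhds.congr fun n =>
      (averagedStep_of_ge ha n (by linarith [hsum n])).symm)
  · exact le_of_tendsto (hlim k x).abs
      ((eventually_ge_atTop k).mono fun n hn => abs_iteratedDeriv_averagedStep_le ha hn x)

end averagedStep

/-! ### The cutoff function of a growth function -/

theorem IsGrowthFunction.antitoneOn {L : ℝ → ℝ} (hL : IsGrowthFunction L) :
    AntitoneOn (fun t : ℝ => 1 / ((t + 1) * L t)) (Ici 0) := by
  intro s hs t ht hst
  have hs' : (0 : ℝ) ≤ s := hs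
  have h1 := hL.one_le s hs
  have h2 := hL.monotoneOn hs ht hst
  have : (s + 1) * L s ≤ (t + 1) * L t :=
    mul_le_mul (by linarith) h2 (by linarith) (by linarith)
  exact one_div_le_one_div_of_le (by positivity) this

theorem IsGrowthFunction.sum_le_growthConst {L : ℝ → ℝ} (hL : IsGrowthFunction L) (n : ℕ) :
    ∑ i ∈ Finset.range n, 1 / (((i : ℝ) + 1) * L i) ≤ growthConst L := by
  set f : ℝ → ℝ := fun t => 1 / ((t + 1) * L t) with hf
  have hnn : ∀ t, 0 ≤ t → 0 ≤ f t := fun t ht => by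
    have := hL.one_le t ht
    rw [hf]; positivity
  have hint : ∀ m : ℕ, ∑ i ∈ Finset.range m, f ((i + 1 : ℕ) : ℝ) ≤ ∫ t in Ioi (0 : ℝ), f t := by
    intro m
    have h := AntitoneOn.sum_le_integral (f := f) (x₀ := 0) (a := m)
      (hL.antitoneOn.mono fun t ht => ht.1)
    simp only [zero_add] at h
    refine h.trans ?_
    rw [intervalIntegral.integral_of_le (Nat.cast_nonneg m)]
    exact setIntegral_mono_set hL.integrableOn
      ((ae_restrict_iff' measurableSet_Ioi).2 (ae_of_all _ fun t ht => hnn t (le_of_lt ht)))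
      (Ioc_subset_Ioi_self.eventuallyLE)
  -- The term `i = 0` equals 1 and is absorbed by the summand 1 in `growthConst`; the other terms
  -- are compared with the integral.
  rcases n with _ | m
  · have : 0 ≤ ∫ t in Ioi (0 : ℝ), f t := by simpa using hint 0
    simp only [Finset.range_zero, Finset.sum_empty, growthConst]
    linarith
  · rw [Finset.sum_range_succ', growthConst, add_comm]
    have := hint m
    simp only [Nat.cast_zero, hL.map_zero, zero_add, one_mul, div_one]
    exact add_le_add le_rfl this

theorem IsGrowthFunction.one_le_growthConst {L : ℝ → ℝ} (hL : IsGrowthFunction L) :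
    1 ≤ growthConst L := by
  simpa [hL.map_zero] using hL.sum_le_growthConst 1

/-- Monotonicity of `L` lets `L(N - 1)` replace every `L(i)` with `i < k ≤ N`. The same rate then
holds at all orders up to `N`, as the Leibniz arguments below need. For `N = 0` the value `L(-1)`
only appears to the power 0. -/
theorem IsGrowthFunction.exists_cutoff {L : ℝ → ℝ} (hL : IsGrowthFunction L) :
    ∃ g : ℝ → ℝ, ContDiff ℝ ∞ g ∧ (∀ x, g x ∈ Icc (0 : ℝ) 1) ∧ (∀ x ≤ 1, g x = 1) ∧
      (∀ x, 2 ≤ x → g x = 0) ∧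
      ∀ N k : ℕ, k ≤ N → ∀ x,
        |iteratedDeriv k g x| ≤ k.factorial * (4 * growthConst L * L ((N : ℝ) - 1)) ^ k := by
  have hM : 0 < growthConst L := zero_lt_one.trans_le hL.one_le_growthConst
  have hLpos : ∀ n : ℕ, 0 < L n := fun n => zero_lt_one.trans_le (hL.one_le n n.cast_nonneg)
  obtain ⟨g, hg, hg01, hg1, hg0, hbound⟩ := exists_cutoff_of_sum_le
    (a := fun n => 1 / (((n : ℝ) + 1) * L n) * (1 / (2 * growthConst L)))
    (fun n => by have := hLpos n; positivity)
    (fun n => by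
      rw [← Finset.sum_mul, mul_one_div, div_le_iff₀ (by positivity)]
      linarith [hL.sum_le_growthConst n])
  refine ⟨g, hg, hg01, hg1, hg0, fun N k hkN x => (hbound k x).trans ?_⟩
  have hterm : ∀ i ∈ Finset.range k,
      2 / (1 / (((i : ℝ) + 1) * L i) * (1 / (2 * growthConst L))) ≤
        ((i : ℝ) + 1) * (4 * growthConst L * L ((N : ℝ) - 1)) := by
    intro i hi
    have hiN : (i : ℝ) + 1 ≤ N := by
      exact_mod_cast (Finset.mem_range.1 hi).trans_le hkN
    have hi0 : (0 : ℝ) ≤ i := i.cast_nonneg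
    have hmono : L i ≤ L ((N : ℝ) - 1) :=
      hL.monotoneOn hi0 (show (0 : ℝ) ≤ (N : ℝ) - 1 by linarith) (by linarith)
    have := hLpos i
    calc 2 / (1 / (((i : ℝ) + 1) * L i) * (1 / (2 * growthConst L)))
        = ((i : ℝ) + 1) * (4 * growthConst L * L i) := by field_simp; norm_num
      _ ≤ _ := by gcongr
  calc ∏ i ∈ Finset.range k, 2 / (1 / (((i : ℝ) + 1) * L i) * (1 / (2 * growthConst L)))
      ≤ ∏ i ∈ Finset.range k, (((i : ℝ) + 1) * (4 * growthConst L * L ((N : ℝ) - 1))) :=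
        Finset.prod_le_prod (fun i _ => by have := hLpos i; positivity) hterm
    _ = k.factorial * (4 * growthConst L * L ((N : ℝ) - 1)) ^ k := by
        rw [Finset.prod_mul_distrib, Finset.prod_const, Finset.card_range,
          ← Finset.prod_range_add_one_eq_factorial]
        push_cast
        rfl

/-! ### Calculus of derivative bounds -/

/-- The function `f` is smooth and its derivatives up to order `N` satisfy
`|f⁽ᵏ⁾| ≤ k! Rᵏ`. -/
def HasGeometricDerivs (N : ℕ) (R : ℝ) (f : ℝ → ℝ) : Prop :=
  ContDiff ℝ ∞ f ∧ ∀ k ≤ N, ∀ x, |iteratedDeriv k f x| ≤ k.factorial * R ^ k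

namespace HasGeometricDerivs

variable {N : ℕ} {R : ℝ} {f h : ℝ → ℝ}

theorem mono (hf : HasGeometricDerivs N R f) (hR : 0 ≤ R) {R' : ℝ} (hRR' : R ≤ R') :
    HasGeometricDerivs N R' f :=
  ⟨hf.1, fun k hk x => (hf.2 k hk x).trans (by gcongr)⟩

theorem const_mul (hf : HasGeometricDerivs N R f) {c : ℝ} (hc : |c| ≤ 1) :
    HasGeometricDerivs N R fun x => c * f x := by
  refine ⟨contDiff_const.mul hf.1, fun k hk x => ?_⟩
  rw [iteratedDeriv_const_mul_field, abs_mul]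
  exact (mul_le_of_le_one_left (abs_nonneg _) hc).trans (hf.2 k hk x)

theorem comp_two_mul (hf : HasGeometricDerivs N R f) :
    HasGeometricDerivs N (2 * R) fun x => f (2 * x) := by
  refine ⟨hf.1.comp (by fun_prop), fun k hk x => ?_⟩
  rw [iteratedDeriv_comp_const_mul (hf.1.of_le (by exact_mod_cast le_top)), abs_mul, abs_pow,
    abs_of_pos (two_pos (α := ℝ)), mul_pow]
  calc (2 : ℝ) ^ k * |iteratedDeriv k f (2 * x)| ≤ 2 ^ k * (k.factorial * R ^ k) := by
        gcongr; exact hf.2 k hk _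
    _ = _ := by ring

theorem mul (hf : HasGeometricDerivs N R f) (hh : HasGeometricDerivs N R h) (hR : 0 ≤ R) :
    HasGeometricDerivs N (2 * R) fun x => f x * h x := by
  refine ⟨hf.1.mul hh.1, fun k hk x => ?_⟩
  rw [iteratedDeriv_fun_mul (hf.1.contDiffAt.of_le (by exact_mod_cast le_top))
    (hh.1.contDiffAt.of_le (by exact_mod_cast le_top))]
  have hterm : ∀ i ∈ Finset.range (k + 1),
      |(k.choose i : ℝ) * iteratedDeriv i f x * iteratedDeriv (k - i) h x| ≤
        k.factorial * R ^ k := by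
    intro i hi
    have hik : i ≤ k := Nat.lt_succ_iff.1 (Finset.mem_range.1 hi)
    rw [abs_mul, abs_mul, Nat.abs_cast]
    calc (k.choose i : ℝ) * |iteratedDeriv i f x| * |iteratedDeriv (k - i) h x|
        ≤ k.choose i * (i.factorial * R ^ i) * ((k - i).factorial * R ^ (k - i)) := by
          gcongr
          · exact hf.2 i (hik.trans hk) x
          · exact hh.2 (k - i) ((Nat.sub_le _ _).trans hk) x
      _ = (k.choose i * i.factorial * (k - i).factorial : ℕ) * (R ^ i * R ^ (k - i)) := by
          push_cast; ring
      _ = k.factorial * R ^ k := by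
          rw [Nat.choose_mul_factorial_mul_factorial hik, ← pow_add, Nat.add_sub_cancel' hik]
  -- Each of the `k + 1` Leibniz terms is at most `k! Rᵏ`; doubling the rate pays for their number.
  have hk2 : ((k : ℝ) + 1) ≤ 2 ^ k := by exact_mod_cast Nat.succ_le_of_lt k.lt_two_pow_self
  calc _ ≤ ∑ i ∈ Finset.range (k + 1), (k.factorial : ℝ) * R ^ k :=
        (Finset.abs_sum_le_sum_abs _ _).trans (Finset.sum_le_sum hterm)
    _ = ((k : ℝ) + 1) * (k.factorial * R ^ k) := by simp
    _ ≤ 2 ^ k * (k.factorial * R ^ k) := by gcongr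
    _ = k.factorial * (2 * R) ^ k := by rw [mul_pow]; ring

theorem sum_range_succ_div_four_pow_le (n : ℕ) :
    ∑ i ∈ Finset.range n, 2 * ((i : ℝ) + 1) / 4 ^ (i + 1) ≤ 1 := by
  -- The bound 1 alone is not inductive; the subtracted term dominates the remaining tail.
  have key : ∑ i ∈ Finset.range n, 2 * ((i : ℝ) + 1) / 4 ^ (i + 1) ≤ 1 - ((n : ℝ) + 1) / 4 ^ n := by
    induction n with
    | zero => simp
    | succ n ih =>
      rw [Finset.sum_range_succ]
      have : 2 * ((n : ℝ) + 1) / 4 ^ (n + 1) + (((n + 1 : ℕ) : ℝ) + 1) / 4 ^ (n + 1) ≤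
          ((n : ℝ) + 1) / 4 ^ n := by
        rw [← add_div, div_le_div_iff₀ (by positivity) (by positivity), pow_succ]
        push_cast
        have : (0 : ℝ) < 4 ^ n := by positivity
        have hn : (0 : ℝ) ≤ n := n.cast_nonneg
        nlinarith [mul_nonneg this.le hn]
      linarith
  have : 0 ≤ ((n : ℝ) + 1) / 4 ^ n := by positivity
  linarith

/-- Inductive step for `sin (b f)` and `cos (b f)`: each derivative is `±b f'` times the other
function. In the Leibniz sum, the gap between the rates `R` and `4 R` leaves weights `(i + 1) / 4 ^
(i + 1)`, whose sum doubled stays below 1; this is why the factor 4 suffices for `|b| ≤ 2`. -/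
theorem abs_iteratedDeriv_deriv_mul_le (hR : 0 ≤ R) (hf : ContDiff ℝ ∞ f) (hh : ContDiff ℝ ∞ h)
    {k : ℕ} {x b : ℝ} (hb : |b| ≤ 2)
    (hfk : ∀ i ≤ k + 1, |iteratedDeriv i f x| ≤ i.factorial * R ^ i)
    (hhk : ∀ i ≤ k, |iteratedDeriv i h x| ≤ i.factorial * (4 * R) ^ i) :
    |iteratedDeriv k (fun y => b * (deriv f y * h y)) x| ≤ (k + 1).factorial * (4 * R) ^ (k + 1) := by
  have hf' : ContDiff ℝ ∞ (deriv f) := (contDiff_infty_iff_deriv.1 hf).2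
  rw [iteratedDeriv_const_mul_field,
    iteratedDeriv_fun_mul (hf'.contDiffAt.of_le (by exact_mod_cast le_top))
    (hh.contDiffAt.of_le (by exact_mod_cast le_top)), abs_mul]
  have hterm : ∀ i ∈ Finset.range (k + 1),
      |(k.choose i : ℝ) * iteratedDeriv i (deriv f) x * iteratedDeriv (k - i) h x| ≤
        k.factorial * (4 * R) ^ (k + 1) * (((i : ℝ) + 1) / 4 ^ (i + 1)) := by
    intro i hi
    have hik : i ≤ k := Nat.lt_succ_iff.1 (Finset.mem_range.1 hi)
    rw [abs_mul, abs_mul, Nat.abs_cast, ← iteratedDeriv_succ']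
    have hpow : (4 * R) ^ (k + 1) = 4 ^ (i + 1) * R ^ (i + 1) * (4 * R) ^ (k - i) := by
      rw [← mul_pow, ← pow_add]; congr 1; omega
    have hfac : (k.choose i : ℝ) * i.factorial * (k - i).factorial = k.factorial := by
      exact_mod_cast Nat.choose_mul_factorial_mul_factorial hik
    calc (k.choose i : ℝ) * |iteratedDeriv (i + 1) f x| * |iteratedDeriv (k - i) h x|
        ≤ k.choose i * ((i + 1).factorial * R ^ (i + 1)) *
            ((k - i).factorial * (4 * R) ^ (k - i)) := by
          gcongr
          · exact hfk (i + 1) (by omega)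
          · exact hhk (k - i) (Nat.sub_le _ _)
      _ = k.factorial * (4 * R) ^ (k + 1) * (((i : ℝ) + 1) / 4 ^ (i + 1)) := by
          rw [hpow, ← hfac, Nat.factorial_succ]
          push_cast
          field_simp
  have hfac : (k.factorial : ℝ) ≤ (k + 1).factorial := by
    exact_mod_cast Nat.factorial_le k.le_succ
  calc _ ≤ 2 * ∑ i ∈ Finset.range (k + 1),
        (k.factorial * (4 * R) ^ (k + 1) * (((i : ℝ) + 1) / 4 ^ (i + 1))) := by
        gcongr
        exact (Finset.abs_sum_le_sum_abs _ _).trans (Finset.sum_le_sum hterm)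
    _ = k.factorial * (4 * R) ^ (k + 1) *
        ∑ i ∈ Finset.range (k + 1), 2 * ((i : ℝ) + 1) / 4 ^ (i + 1) := by
        rw [Finset.mul_sum, Finset.mul_sum]
        exact Finset.sum_congr rfl fun i _ => by ring
    _ ≤ k.factorial * (4 * R) ^ (k + 1) * 1 := by
        gcongr; exact sum_range_succ_div_four_pow_le _
    _ ≤ (k + 1).factorial * (4 * R) ^ (k + 1) := by rw [mul_one]; gcongr

theorem sin_cos (hf : HasGeometricDerivs N R f) (hR : 0 ≤ R) {b : ℝ} (hb : |b| ≤ 2) :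
    HasGeometricDerivs N (4 * R) (fun x => Real.sin (b * f x)) ∧
      HasGeometricDerivs N (4 * R) fun x => Real.cos (b * f x) := by
  have hbf : ContDiff ℝ ∞ fun x => b * f x := contDiff_const.mul hf.1
  have hs : ContDiff ℝ ∞ fun x => Real.sin (b * f x) := hbf.sin
  have hc : ContDiff ℝ ∞ fun x => Real.cos (b * f x) := hbf.cos
  have hd : ∀ x, HasDerivAt (fun x => b * f x) (b * deriv f x) x := fun x =>
    ((contDiff_infty_iff_deriv.1 hf.1).1 x).hasDerivAt.const_mul b
  have hds : deriv (fun x => Real.sin (b * f x)) =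
      fun x => b * (deriv f x * Real.cos (b * f x)) := by
    funext x; rw [(hd x).sin.deriv]; ring
  have hdc : deriv (fun x => Real.cos (b * f x)) =
      fun x => -b * (deriv f x * Real.sin (b * f x)) := by
    funext x; rw [(hd x).cos.deriv]; ring
  have key : ∀ k ≤ N, ∀ x,
      |iteratedDeriv k (fun x => Real.sin (b * f x)) x| ≤ k.factorial * (4 * R) ^ k ∧
        |iteratedDeriv k (fun x => Real.cos (b * f x)) x| ≤ k.factorial * (4 * R) ^ k := by
    intro k
    induction k using Nat.strong_induction_on with
    | _ k ih =>
      intro hk x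
      rcases k with _ | k
      · simp [Real.abs_sin_le_one, Real.abs_cos_le_one]
      · rw [iteratedDeriv_succ', iteratedDeriv_succ', hds, hdc]
        exact ⟨abs_iteratedDeriv_deriv_mul_le hR hf.1 hc hb
            (fun i hi => hf.2 i (hi.trans hk) x)
            fun i hi => (ih i (by omega) (by omega) x).2,
          abs_iteratedDeriv_deriv_mul_le hR hf.1 hs (by rwa [abs_neg])
            (fun i hi => hf.2 i (hi.trans hk) x)
            fun i hi => (ih i (by omega) (by omega) x).1⟩
  exact ⟨⟨hs, fun k hk x => (key k hk x).1⟩, ⟨hc, fun k hk x => (key k hk x).2⟩⟩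

end HasGeometricDerivs

/-! ### Multivariate cutoff functions -/

theorem mem_smallDerivClass_of_hasGeometricDerivs {d : ℕ} (hd : 1 ≤ d) {L : ℝ → ℝ}
    (hL : IsGrowthFunction L) {A : (Fin d → ℝ) → ℝ} (hA : ContDiff ℝ ∞ A)
    (hA1 : ∀ t, |A t| ≤ 1)
    (hder : ∀ k : ℕ, 1 ≤ k → ∀ t ∈ orthant d, ∀ j,
      HasGeometricDerivs k (64 * growthConst L * L ((k : ℝ) - 1))
        fun s => A (Function.update t j s)) :
    A ∈ smallDerivClass d L 8
        (10 * (d : ℝ) * (2 * (d : ℝ) - 1) * growthConst L *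
          (8 * ((d : ℝ) + 2) * growthConst L + 1)) := by
  have hM := hL.one_le_growthConst
  have hd' : (1 : ℝ) ≤ d := by exact_mod_cast hd
  set γ' : ℝ := 10 * (d : ℝ) * (2 * (d : ℝ) - 1) * growthConst L *
    (8 * ((d : ℝ) + 2) * growthConst L + 1) with hγ
  -- There is ample room: `d (2 d - 1) ≥ 1` and the last factor is at least 24, so `γ' ≥ 240 M`.
  have hconst : 64 * growthConst L ≤ γ' := by
    have h1 : (1 : ℝ) ≤ d * (2 * d - 1) := by nlinarith
    have h2 : (24 : ℝ) ≤ 8 * ((d : ℝ) + 2) * growthConst L + 1 := by nlinarith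
    have h3 : (24 : ℝ) ≤ d * (2 * d - 1) * (8 * ((d : ℝ) + 2) * growthConst L + 1) := by nlinarith
    have h4 : growthConst L * 24 ≤
        growthConst L * (d * (2 * d - 1) * (8 * ((d : ℝ) + 2) * growthConst L + 1)) := by gcongr
    have h5 : γ' = 10 * (growthConst L *
        (d * (2 * d - 1) * (8 * ((d : ℝ) + 2) * growthConst L + 1))) := by rw [hγ]; ring
    linarith
  refine ⟨hA.contDiffOn, fun t _ => (hA1 t).trans (by norm_num), fun k hk j t ht => ?_⟩
  have hk' : (0 : ℝ) ≤ (k : ℝ) - 1 := by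
    have : (1 : ℝ) ≤ k := by exact_mod_cast hk
    linarith
  have hLk := hL.one_le _ hk'
  have hg := hder k hk t ht j
  -- The restriction to the line is smooth on all of `ℝ`, so one-sided derivatives at the boundary
  -- are ordinary ones.
  rw [partialDeriv, iteratedDerivWithin_eq_iteratedDeriv (uniqueDiffOn_Ici 0)
    (hg.1.contDiffAt.of_le (by exact_mod_cast le_top)) (ht j), one_div_mul_eq_div,
    div_le_iff₀ (by positivity)]
  calc |iteratedDeriv k (fun s => A (Function.update t j s)) (t j)|
      ≤ k.factorial * (64 * growthConst L * L ((k : ℝ) - 1)) ^ k := hg.2 k le_rfl _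
    _ ≤ k.factorial * (γ' * L ((k : ℝ) - 1)) ^ k := by gcongr
    _ ≤ 8 * (γ' * L ((k : ℝ) - 1)) ^ k * k.factorial := by
        have hγ0 : 0 ≤ γ' := by linarith
        have : 0 ≤ (k.factorial : ℝ) * (γ' * L ((k : ℝ) - 1)) ^ k := by positivity
        linarith

/-- The product `t ↦ g (t 1) ⋯ g (t d)`. -/
noncomputable def tensorCutoff (d : ℕ) (g : ℝ → ℝ) (t : Fin d → ℝ) : ℝ :=
  ∏ i, g (t i)

/-- The dyadic cutoff function `sin (π / 2 * G t) * cos (π / 2 * G (2 t))` for the tensor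
product `G`. -/
noncomputable def dyadicCutoff (d : ℕ) (g : ℝ → ℝ) (t : Fin d → ℝ) : ℝ :=
  Real.sin (Real.pi / 2 * tensorCutoff d g t) *
    Real.cos (Real.pi / 2 * tensorCutoff d g ((2 : ℝ) • t))

section Cutoff

variable {d : ℕ} {g : ℝ → ℝ}

theorem contDiff_tensorCutoff (hg : ContDiff ℝ ∞ g) : ContDiff ℝ ∞ (tensorCutoff d g) :=
  contDiff_prod fun i _ => hg.comp (contDiff_apply ℝ ℝ i)

theorem tensorCutoff_mem_Icc (hg : ∀ x, g x ∈ Icc (0 : ℝ) 1) (t : Fin d → ℝ) :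
    tensorCutoff d g t ∈ Icc (0 : ℝ) 1 :=
  ⟨Finset.prod_nonneg fun i _ => (hg (t i)).1,
    Finset.prod_le_one (fun i _ => (hg (t i)).1) fun i _ => (hg (t i)).2⟩

theorem tensorCutoff_eq_one (hg : ∀ x ≤ 1, g x = 1) {t : Fin d → ℝ} (ht : ∀ i, t i ≤ 1) :
    tensorCutoff d g t = 1 :=
  Finset.prod_eq_one fun i _ => hg _ (ht i)

theorem tensorCutoff_eq_zero (hg : ∀ x, 2 ≤ x → g x = 0) {t : Fin d → ℝ} {i : Fin d}
    (ht : 2 ≤ t i) : tensorCutoff d g t = 0 :=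
  Finset.prod_eq_zero (Finset.mem_univ i) (hg _ ht)

theorem tensorCutoff_update (t : Fin d → ℝ) (j : Fin d) (s : ℝ) :
    tensorCutoff d g (Function.update t j s) = (∏ i ∈ Finset.univ.erase j, g (t i)) * g s := by
  rw [tensorCutoff, ← Finset.mul_prod_erase _ _ (Finset.mem_univ j), Function.update_self, mul_comm]
  congr 1
  exact Finset.prod_congr rfl fun i hi => by rw [Function.update_of_ne (Finset.ne_of_mem_erase hi)]

theorem exists_norm_le_apply {t : Fin d → ℝ} (ht : t ∈ orthant d) (k : Fin d) :
    ∃ i, ‖t‖ ≤ t i := by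
  have : Nonempty (Fin d) := ⟨k⟩
  obtain ⟨i, hi⟩ := Finite.exists_max t
  refine ⟨i, (pi_norm_le_iff_of_nonneg (ht i)).2 fun l => ?_⟩
  rw [Real.norm_eq_abs, abs_of_nonneg (ht l)]
  exact hi l

theorem tensorCutoff_coordProj (hg1 : ∀ x ≤ 1, g x = 1) (hg0 : ∀ x, 2 ≤ x → g x = 0)
    {t : Fin d → ℝ} (ht : t ∈ orthant d) {k : Fin d} (hk : t k ≤ 1 / 2 * ‖t‖) :
    tensorCutoff d g t = tensorCutoff d g (coordProj k t) := by
  -- If `‖t‖ < 2`, then `t k < 1` lies on the plateau of `g`. Otherwise a coordinate other than `k`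
  -- is at least 2 and both sides vanish.
  rcases lt_or_ge ‖t‖ 2 with h | h
  · have heq := tensorCutoff_update (g := g) t k (t k)
    rw [Function.update_eq_self] at heq
    rw [coordProj, tensorCutoff_update, heq, hg1 (t k) (by linarith), hg1 0 zero_le_one]
  · obtain ⟨i, hi⟩ := exists_norm_le_apply ht k
    have hik : i ≠ k := by
      rintro rfl
      linarith
    rw [tensorCutoff_eq_zero hg0 (i := i) (by linarith),
      tensorCutoff_eq_zero hg0 (t := coordProj k t) (i := i)
        (by rw [coordProj, Function.update_of_ne hik]; linarith)]

theorem hasGeometricDerivs_tensorCutoff {N : ℕ} {R : ℝ} (hgR : HasGeometricDerivs N R g)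
    (hg : ∀ x, g x ∈ Icc (0 : ℝ) 1) (t : Fin d → ℝ) (j : Fin d) :
    HasGeometricDerivs N R fun s => tensorCutoff d g (Function.update t j s) := by
  simp only [tensorCutoff_update]
  refine hgR.const_mul (abs_le.2 ⟨?_, Finset.prod_le_one (fun i _ => (hg _).1) fun i _ => (hg _).2⟩)
  exact (neg_nonpos.2 zero_le_one).trans (Finset.prod_nonneg fun i _ => (hg _).1)

theorem closure_support_subset {A : (Fin d → ℝ) → ℝ} (hA : ∀ t i, 2 ≤ t i → A t = 0) :
    closure {t | t ∈ orthant d ∧ A t ≠ 0} ⊆ {t | ∀ i, t i ∈ Icc (0 : ℝ) 2} := by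
  refine closure_minimal (fun t ht i => ⟨ht.1 i, ?_⟩) ?_
  · by_contra h
    exact ht.2 (hA t i (not_le.1 h).le)
  · have : {t : Fin d → ℝ | ∀ i, t i ∈ Icc (0 : ℝ) 2} = Set.pi univ fun _ => Icc 0 2 := by
      ext t; simp only [Set.mem_pi, mem_univ, true_imp_iff, mem_ofPred_eq]
    rw [this]
    exact isClosed_set_pi fun _ _ => isClosed_Icc

theorem apply_le_one_of_mem_ballOne {t : Fin d → ℝ} (ht : t ∈ ballOne d) (i : Fin d) :
    t i ≤ 1 :=
  (le_abs_self _).trans ((Finset.single_le_sum (f := fun i => |t i|)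
    (fun i _ => abs_nonneg (t i)) (Finset.mem_univ i)).trans ht.2)

theorem isAdmissibleSecondKind_tensorCutoff (hg : ContDiff ℝ ∞ g) (hg1 : ∀ x ≤ 1, g x = 1)
    (hg0 : ∀ x, 2 ≤ x → g x = 0) : IsAdmissibleSecondKind .a (tensorCutoff d g) where
  contDiffOn := (contDiff_tensorCutoff hg).contDiffOn
  support_subset := closure_support_subset fun _ _ h => tensorCutoff_eq_zero hg0 h
  eq_proj _ ht _ hk := tensorCutoff_coordProj hg1 hg0 ht hk
  hasType _ ht := tensorCutoff_eq_one hg1 (apply_le_one_of_mem_ballOne ht)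

theorem contDiff_dyadicCutoff (hg : ContDiff ℝ ∞ g) : ContDiff ℝ ∞ (dyadicCutoff d g) := by
  have hG := contDiff_tensorCutoff (d := d) hg
  have hG2 : ContDiff ℝ ∞ fun t : Fin d → ℝ => tensorCutoff d g ((2 : ℝ) • t) :=
    hG.comp (contDiff_const_smul (2 : ℝ))
  exact (contDiff_const.mul hG).sin.mul (contDiff_const.mul hG2).cos

theorem dyadicCutoff_mem_Icc (hg : ∀ x, g x ∈ Icc (0 : ℝ) 1) (t : Fin d → ℝ) :
    dyadicCutoff d g t ∈ Icc (0 : ℝ) 1 := by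
  have h1 := tensorCutoff_mem_Icc hg t
  have h2 := tensorCutoff_mem_Icc hg ((2 : ℝ) • t)
  have hpi := Real.pi_pos
  have hs : 0 ≤ Real.sin (Real.pi / 2 * tensorCutoff d g t) :=
    Real.sin_nonneg_of_nonneg_of_le_pi (mul_nonneg (by positivity) h1.1) (by nlinarith [h1.2])
  have hc : 0 ≤ Real.cos (Real.pi / 2 * tensorCutoff d g ((2 : ℝ) • t)) :=
    Real.cos_nonneg_of_neg_pi_div_two_le_of_le (by nlinarith [h2.1]) (by nlinarith [h2.2])
  exact ⟨mul_nonneg hs hc, mul_le_one₀ (Real.sin_le_one _) hc (Real.cos_le_one _)⟩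

theorem sq_dyadicCutoff (hg1 : ∀ x ≤ 1, g x = 1) (hg0 : ∀ x, 2 ≤ x → g x = 0) (t : Fin d → ℝ) :
    dyadicCutoff d g t ^ 2 = Real.sin (Real.pi / 2 * tensorCutoff d g t) ^ 2 -
      Real.sin (Real.pi / 2 * tensorCutoff d g ((2 : ℝ) • t)) ^ 2 := by
  -- Always `G(t) = 1` or `G(2t) = 0`, and the identity is elementary in either case.
  by_cases h : ∀ i, t i ≤ 1
  · rw [dyadicCutoff, tensorCutoff_eq_one hg1 h, mul_one, Real.sin_pi_div_two, one_mul,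
      Real.cos_sq']
    ring
  · push Not at h
    obtain ⟨i, hi⟩ := h
    rw [dyadicCutoff, tensorCutoff_eq_zero hg0 (t := (2 : ℝ) • t) (i := i)
      (by rw [Pi.smul_apply, smul_eq_mul]; linarith)]
    simp

theorem hasSum_sq_dyadicCutoff (hg1 : ∀ x ≤ 1, g x = 1) (hg0 : ∀ x, 2 ≤ x → g x = 0)
    {t : Fin d → ℝ} {i : Fin d} (hi : 1 ≤ t i) :
    HasSum (fun j : ℕ => |dyadicCutoff d g (((2 : ℝ) ^ j)⁻¹ • t)| ^ 2) 1 := by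
  rw [hasSum_iff_tendsto_nat_of_nonneg fun j => by positivity]
  -- Telescoping sequence: `p 0 = 0` because `2 t i ≥ 2`, and `p m = 1` once `2 · 2⁻ᵐ t` has all
  -- coordinates at most 1.
  set p : ℕ → ℝ := fun j =>
    Real.sin (Real.pi / 2 * tensorCutoff d g ((2 * ((2 : ℝ) ^ j)⁻¹) • t)) ^ 2 with hp
  have hterm : ∀ j : ℕ, |dyadicCutoff d g (((2 : ℝ) ^ j)⁻¹ • t)| ^ 2 = p (j + 1) - p j := by
    intro j
    rw [sq_abs, sq_dyadicCutoff hg1 hg0, smul_smul, hp]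
    simp only
    rw [show (2 : ℝ) * (2 ^ (j + 1))⁻¹ = (2 ^ j)⁻¹ by rw [pow_succ]; field_simp]
  have hp0 : p 0 = 0 := by
    simp only [hp, pow_zero, inv_one, mul_one]
    rw [tensorCutoff_eq_zero hg0 (i := i) (by rw [Pi.smul_apply, smul_eq_mul]; linarith)]
    simp
  simp_rw [hterm, Finset.sum_range_sub, hp0, sub_zero]
  refine tendsto_const_nhds.congr' ?_
  obtain ⟨n, hn⟩ := pow_unbounded_of_one_lt (2 * ‖t‖) (one_lt_two (α := ℝ))
  filter_upwards [eventually_ge_atTop n] with m hm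
  have hm' : 2 * ‖t‖ ≤ 2 ^ m := hn.le.trans (pow_le_pow_right₀ one_le_two hm)
  rw [hp]
  simp only
  rw [tensorCutoff_eq_one hg1 fun l => ?_]
  · simp
  · rw [Pi.smul_apply, smul_eq_mul, mul_right_comm, ← div_eq_mul_inv, div_le_one (by positivity)]
    have := (le_abs_self _).trans (norm_le_pi_norm t l)
    linarith

theorem dyadicCutoff_eq_zero_of_mem (hg1 : ∀ x ≤ 1, g x = 1) {t : Fin d → ℝ}
    (ht : t ∈ (1 / 2 : ℝ) • ballOne d) : dyadicCutoff d g t = 0 := by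
  obtain ⟨u, hu, rfl⟩ := ht
  have : (2 : ℝ) • (fun x => (1 / 2 : ℝ) • x) u = u := by simp [smul_smul]
  rw [dyadicCutoff, this, tensorCutoff_eq_one hg1 (apply_le_one_of_mem_ballOne hu), mul_one,
    Real.cos_pi_div_two, mul_zero]

theorem hasCutoffType_dyadicCutoff (hg1 : ∀ x ≤ 1, g x = 1) (hg0 : ∀ x, 2 ≤ x → g x = 0) :
    HasCutoffType (dyadicCutoff d g) .c := by
  refine ⟨fun t ht => dyadicCutoff_eq_zero_of_mem hg1 ht, fun t ht => ?_⟩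
  obtain ⟨i, hi⟩ : ∃ i, 1 ≤ t i := by
    by_contra! h
    exact ht.2 fun i => ⟨ht.1 i, h i⟩
  exact hasSum_sq_dyadicCutoff hg1 hg0 hi

theorem isAdmissibleSecondKind_dyadicCutoff {τ : CutoffType} (hg : ContDiff ℝ ∞ g)
    (hg1 : ∀ x ≤ 1, g x = 1) (hg0 : ∀ x, 2 ≤ x → g x = 0)
    (hτ : HasCutoffType (dyadicCutoff d g) τ) :
    IsAdmissibleSecondKind τ (dyadicCutoff d g) where
  contDiffOn := (contDiff_dyadicCutoff hg).contDiffOn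
  support_subset := closure_support_subset fun t i h => by
    rw [dyadicCutoff, tensorCutoff_eq_zero hg0 h, mul_zero, Real.sin_zero, zero_mul]
  eq_proj t ht k hk := by
    -- The condition `t k ≤ ‖t‖ / 2` is invariant under dilation, so it also applies to the factor
    -- in `2 t`.
    have h2 : (2 : ℝ) • coordProj k t = coordProj k ((2 : ℝ) • t) := by
      rw [coordProj, coordProj, ← Function.update_smul, smul_zero]
    rw [dyadicCutoff, dyadicCutoff, ← tensorCutoff_coordProj hg1 hg0 ht hk, h2,
      ← tensorCutoff_coordProj hg1 hg0 (t := (2 : ℝ) • t) (fun i => ?_) ?_]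
    · rw [norm_smul, Pi.smul_apply, smul_eq_mul, Real.norm_ofNat]
      linarith
    · rw [Pi.smul_apply, smul_eq_mul]
      exact mul_nonneg zero_le_two (ht i)
  hasType := hτ

theorem hasGeometricDerivs_dyadicCutoff {N : ℕ} {R : ℝ} (hR : 0 ≤ R)
    (hgR : HasGeometricDerivs N R g) (hg : ∀ x, g x ∈ Icc (0 : ℝ) 1) (t : Fin d → ℝ)
    (j : Fin d) :
    HasGeometricDerivs N (16 * R) fun s => dyadicCutoff d g (Function.update t j s) := by
  have hb : |Real.pi / 2| ≤ 2 := by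
    rw [abs_of_pos (by positivity)]
    linarith [Real.pi_le_four]
  have h1 := ((hasGeometricDerivs_tensorCutoff hgR hg t j).sin_cos hR hb).1
  have h2 := (((hasGeometricDerivs_tensorCutoff hgR hg ((2 : ℝ) • t) j).comp_two_mul).sin_cos
    (by positivity) hb).2
  -- The sine factor has rate `4 R`, the dilated cosine `8 R`; the product rule needs the common
  -- rate `8 R`.
  have h := (h1.mono (R' := 4 * (2 * R)) (by positivity) (by linarith)).mul h2 (by positivity)
  rw [show 16 * R = 2 * (4 * (2 * R)) by ring]
  simpa only [dyadicCutoff, ← Function.update_smul, smul_eq_mul] using h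

end Cutoff

theorem mainTheorem9 (d : ℕ) (hd : 1 ≤ d) (L : ℝ → ℝ) (hL : IsGrowthFunction L)
    (hconv : ConvexOn ℝ (Set.Ici 0) (fun t : ℝ => (t + 1) * Real.log (L t)))
    (τ : CutoffType) :
    ∃ A ∈ smallDerivClass d L 8
        (10 * (d : ℝ) * (2 * (d : ℝ) - 1) * growthConst L *
          (8 * ((d : ℝ) + 2) * growthConst L + 1)),
      IsAdmissibleSecondKind τ A ∧ ∀ t ∈ orthant d, 0 ≤ A t ∧ A t ≤ 1 := by
  obtain ⟨g, hg, hg01, hg1, hg0, hbound⟩ := hL.exists_cutoff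
  have hgR : ∀ k : ℕ, HasGeometricDerivs k (4 * growthConst L * L ((k : ℝ) - 1)) g :=
    fun k => ⟨hg, fun i hi x => hbound k i hi x⟩
  have hR : ∀ k : ℕ, 1 ≤ k → 0 ≤ 4 * growthConst L * L ((k : ℝ) - 1) := fun k hk => by
    have hM := hL.one_le_growthConst
    have hLk := hL.one_le ((k : ℝ) - 1) (sub_nonneg.2 (by exact_mod_cast hk))
    positivity
  have habs : ∀ {x : ℝ}, x ∈ Icc (0 : ℝ) 1 → |x| ≤ 1 := fun hx => by
    rw [abs_of_nonneg hx.1]; exact hx.2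
  have hdyadic : ∀ σ, HasCutoffType (dyadicCutoff d g) σ → ∃ A ∈ smallDerivClass d L 8
        (10 * (d : ℝ) * (2 * (d : ℝ) - 1) * growthConst L *
          (8 * ((d : ℝ) + 2) * growthConst L + 1)),
      IsAdmissibleSecondKind σ A ∧ ∀ t ∈ orthant d, 0 ≤ A t ∧ A t ≤ 1 := fun σ hσ => by
    refine ⟨dyadicCutoff d g, mem_smallDerivClass_of_hasGeometricDerivs hd hL
      (contDiff_dyadicCutoff hg) (fun t => habs (dyadicCutoff_mem_Icc hg01 t))
      (fun k hk t _ j => ?_), isAdmissibleSecondKind_dyadicCutoff hg hg1 hg0 hσ,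
      fun t _ => dyadicCutoff_mem_Icc hg01 t⟩
    convert hasGeometricDerivs_dyadicCutoff (hR k hk) (hgR k) hg01 t j using 1
    ring
  cases τ with
  | a =>
    refine ⟨tensorCutoff d g, mem_smallDerivClass_of_hasGeometricDerivs hd hL
      (contDiff_tensorCutoff hg) (fun t => habs (tensorCutoff_mem_Icc hg01 t))
      (fun k hk t _ j => ?_), isAdmissibleSecondKind_tensorCutoff hg hg1 hg0,
      fun t _ => tensorCutoff_mem_Icc hg01 t⟩
    have := hR k hk
    exact (hasGeometricDerivs_tensorCutoff (hgR k) hg01 t j).mono this (by linarith)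
  | b => exact hdyadic .b (hasCutoffType_dyadicCutoff hg1 hg0).1
  | c => exact hdyadic .c (hasCutoffType_dyadicCutoff hg1 hg0)
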